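/- There exist absolute constants $c,C,c',M>0$ (with $c$ small enough) such that the following holds. Let $n\ge 1$, $K\ge 2$, $r\ge 1$ be integers, let $\mathcal A_K=\{e^{2\pi \mathrm{i}k/K}: 0\le k\le K-1\}$, and let $Q^\star\in\mathbb C^{n\times n}$ be Hermitian positive semidefinite with eigenvalues $\lambda_1^\star\ge\lambda_2^\star\ge\dots\ge\lambda_n^\star\ge 0$ (counted with multiplicity; $\lambda_j^\star=0$ for $j>n$). Put $$\delta^\star=\min\Bigl\{\min_{1\le j\le r-1}|\lambda_j^\star-\lambda_{j+1}^\star|,\ \lambda_r^\star\Bigr\}$$ and assume $\delta^\star>0$ (so that $r\le \operatorname{rank}Q^\star$). Let $H\in\mathbb C^{n\times n}$ have i.i.d. complex Gaussian entries $H_{ik}\sim\mathcal N_{\mathbb C}(0,\alpha^2)$, that is, with independent real and imaginary parts of law $\mathcal N(0,\alpha^2/2)$, where $0\le\alpha\le c\,\delta^\star/\sqrt n$. Let $Q=Q^\star+H$ have a singular value decomposition $Q=\sum_{i=1}^n\sigma_i u_iv_i^\dagger$ with $\sigma_1\ge\dots\ge\sigma_n\ge 0$, let $Q_r=\sum_{i=1}^r\sigma_iu_iu_i^\dagger$,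 let $z_r\in\mathcal A_K^n$ attain $\max_{z\in\mathcal A_K^n}z^\dagger Q_rz$, and let $\mathrm{OPT}(Q^\star)=\max_{z\in\mathcal A_K^n}z^\dagger Q^\star z$. Then, with probability at least $1-C\exp(-c'n)$, for every choice of the singular value decomposition and of the maximizer $z_r$, $$\bigl|\mathrm{OPT}(Q^\star)-z_r^\dagger Q^\star z_r\bigr|\le M\Bigl(n\,\lambda_{r+1}^\star+\frac{n^{3/2}\,\lambda_1^\star\,\alpha}{\delta^\star}\Bigr).$$ The constants $c,C,c',M$ do not depend on $n,K,r,Q^\star,\alpha$. -/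

import Mathlib

open scoped NNReal Matrix ComplexOrder
open MeasureTheory ProbabilityTheory

namespace LowRankQuad

/-- The `K`-th roots of unity `exp (2 k π i / K)`, `k = 0, …, K - 1`. -/
def alphabet (K : ℕ) : Set ℂ :=
  {w | ∃ k : ℕ, k < K ∧ w = Complex.exp (2 * k * Real.pi * Complex.I / K)}

/-- The feasible vectors: all coordinates are `K`-th roots of unity. -/
def feasible (K n : ℕ) : Set (Fin n → ℂ) :=
  {z | ∀ i, z i ∈ alphabet K}

/-- The quadratic form `z† A z`. It is real when `A` is Hermitian, which is the only case in which
it is used; the real part makes it a real number by type. -/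
noncomputable def quadForm {n : ℕ} (A : Matrix (Fin n) (Fin n) ℂ) (z : Fin n → ℂ) : ℝ :=
  (star z ⬝ᵥ A *ᵥ z).re

/-- `z` attains the maximum of `z† A z` over the feasible vectors. -/
def IsMaximizer {n : ℕ} (K : ℕ) (A : Matrix (Fin n) (Fin n) ℂ) (z : Fin n → ℂ) : Prop :=
  z ∈ feasible K n ∧ ∀ w ∈ feasible K n, quadForm A w ≤ quadForm A z

/-- The optimal value `max z† A z` over the feasible vectors (a maximum over a finite set, see
`isGreatest_opt`). -/
noncomputable def opt {n : ℕ} (K : ℕ) (A : Matrix (Fin n) (Fin n) ℂ) : ℝ :=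
  sSup (quadForm A '' feasible K n)

theorem alphabet_finite (K : ℕ) : (alphabet K).Finite := by
  refine ((Set.finite_lt_nat K).image
    (fun k : ℕ => Complex.exp (2 * k * Real.pi * Complex.I / K))).subset ?_
  rintro w ⟨k, hk, rfl⟩
  exact ⟨k, hk, rfl⟩

theorem feasible_finite (K n : ℕ) : (feasible K n).Finite := by
  refine (Set.Finite.pi' (fun _ : Fin n => alphabet_finite K)).subset ?_
  intro z hz
  exact hz

theorem feasible_nonempty {K : ℕ} (hK : 0 < K) (n : ℕ) : (feasible K n).Nonempty :=
  ⟨fun _ => 1, fun _ => ⟨0, hK, by simp⟩⟩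

theorem isGreatest_opt {n K : ℕ} (hK : 0 < K) (A : Matrix (Fin n) (Fin n) ℂ) :
    IsGreatest (quadForm A '' feasible K n) (opt K A) :=
  ⟨((feasible_nonempty hK n).image _).csSup_mem ((feasible_finite K n).image _),
    fun _ hx => le_csSup ((feasible_finite K n).image _).bddAbove hx⟩

/-- The `j`-th largest eigenvalue (`j = 1, 2, …`, with multiplicity) of a Hermitian `n × n` matrix,
and `0` for `j > n`. -/
noncomputable def eig {n : ℕ} {A : Matrix (Fin n) (Fin n) ℂ} (hA : A.IsHermitian) (j : ℕ) : ℝ :=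
  if h : 1 ≤ j ∧ j ≤ Fintype.card (Fin n) then hA.eigenvalues₀ ⟨j - 1, by omega⟩ else 0

/-- `min {min_{1 ≤ j ≤ r - 1} |λ_j - λ_{j+1}|, λ_r}`. -/
noncomputable def eigengap {n : ℕ} {A : Matrix (Fin n) (Fin n) ℂ} (hA : A.IsHermitian) (r : ℕ) : ℝ :=
  (insert (eig hA r) ((Finset.Icc 1 (r - 1)).image fun j => |eig hA j - eig hA (j + 1)|)).min'
    (Finset.insert_nonempty _ _)

/-- `Q = U diag(σ) V†` is a singular value decomposition with singular values in decreasing order;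
the columns of `U` are the left singular vectors. -/
structure IsSVD {n : ℕ} (Q U V : Matrix (Fin n) (Fin n) ℂ) (σ : Fin n → ℝ) : Prop where
  left_unitary : U ∈ Matrix.unitaryGroup (Fin n) ℂ
  right_unitary : V ∈ Matrix.unitaryGroup (Fin n) ℂ
  antitone : Antitone σ
  nonneg : ∀ i, 0 ≤ σ i
  eq : Q = U * Matrix.diagonal (fun i => (σ i : ℂ)) * Vᴴ

/-- `∑_{i ≤ r} σ_i u_i u_i†`, with `u_i` the columns of `U`. -/
noncomputable def lowRank {n : ℕ} (U : Matrix (Fin n) (Fin n) ℂ) (σ : Fin n → ℝ) (r : ℕ) :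
    Matrix (Fin n) (Fin n) ℂ :=
  ∑ i with i.val < r, (σ i : ℂ) • Matrix.vecMulVec (U.col i) (star (U.col i))

/-- The complex Gaussian law `N_C(0, v)`: independent real and imaginary parts, each `N(0, v/2)`. -/
noncomputable def complexGaussian (v : ℝ≥0) : Measure ℂ :=
  ((gaussianReal 0 (v / 2)).prod (gaussianReal 0 (v / 2))).map
    (fun p : ℝ × ℝ => (⟨p.1, p.2⟩ : ℂ))

end LowRankQuad

namespace LowRankQuad

/-! ### Deterministic perturbation bounds -/

section Deterministic

open scoped Matrix.Norms.L2Operator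
open WithLp Matrix

variable {n : ℕ}

/-! Feasible vectors have squared norm `n`, so replacing `Q⋆` by `Q_r` moves the objective by at
most `n‖Q⋆ - Q_r‖`, and optimising the wrong form costs at most twice that. To bound this norm,
write `Q⋆ + H = U S V†`. Since `Q⋆` is Hermitian, `Q⋆ V = U S - H V` and `Q⋆ U = V S - H† U`;
subtracting gives the Sylvester equation `Q⋆ (V - U) + (V - U) S = H† U - H V`. As `Q⋆ ≥ 0`, its
restriction to the first `r` columns forces `σ_r ‖(V - U) D‖ ≤ 2‖H‖`, where `D` projects on those
columns (`mul_norm_le_norm_mul_add_mul`). Left and right singular vectors thus nearly agree, without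
comparing any of them with eigenvectors of `Q⋆`. With Weyl's inequality this yields
`norm_sub_lowRank_le`; the gap `δ⋆` enters through `δ⋆ ≤ λ_r`. Finally `‖H‖ ≤ 12 α √n` outside an
event of probability `exp (-n)`, by a net argument (`measureReal_norm_gt_le`). -/

theorem abs_re_star_dotProduct_mulVec_le (A : Matrix (Fin n) (Fin n) ℂ) (x y : Fin n → ℂ) :
    |(star x ⬝ᵥ A *ᵥ y).re| ≤ ‖A‖ * ‖toLp 2 x‖ * ‖toLp 2 y‖ := by
  have h : star x ⬝ᵥ A *ᵥ y = inner ℂ (toLp 2 x) (toLp 2 (A *ᵥ y)) := by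
    rw [EuclideanSpace.inner_eq_star_dotProduct, dotProduct_comm]
  rw [h]
  calc _ ≤ ‖inner ℂ (toLp 2 x) (toLp 2 (A *ᵥ y))‖ := Complex.abs_re_le_norm _
    _ ≤ ‖toLp 2 x‖ * ‖toLp 2 (A *ᵥ y)‖ := norm_inner_le_norm _ _
    _ ≤ ‖toLp 2 x‖ * (‖A‖ * ‖toLp 2 y‖) := by
      gcongr
      exact l2_opNorm_mulVec A (toLp 2 y)
    _ = _ := by ring

theorem re_star_dotProduct_self (x : Fin n → ℂ) : (star x ⬝ᵥ x).re = ‖toLp 2 x‖ ^ 2 := by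
  have h : star x ⬝ᵥ x = inner ℂ (toLp 2 x) (toLp 2 x) := by
    rw [EuclideanSpace.inner_eq_star_dotProduct, dotProduct_comm]
  rw [h, inner_self_eq_norm_sq_to_K]
  norm_cast

/-- A bound for the solution of the Sylvester equation `A X + X S = E` with `A` positive
semidefinite and `S ≥ m`. -/
theorem mul_norm_le_norm_mul_add_mul {A S : Matrix (Fin n) (Fin n) ℂ} (hA : A.PosSemidef) {m : ℝ}
    (hS : ∀ w : Fin n → ℂ, m * ‖toLp 2 w‖ ^ 2 ≤ (star w ⬝ᵥ S *ᵥ w).re)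
    (X : Matrix (Fin n) (Fin n) ℂ) : m * ‖X‖ ≤ ‖A * X + X * S‖ := by
  by_cases hX : X = 0
  · simp [hX]
  have hXpos : 0 < ‖X‖ := norm_pos_iff.2 hX
  have : Nontrivial (Matrix (Fin n) (Fin n) ℂ) := ⟨X, 0, hX⟩
  have hG : (Xᴴ * X).PosSemidef := posSemidef_conjTranspose_mul_self X
  -- Test the equation on a top right singular vector `w` of `X`, paired with `X w`: the `A` term is
  -- nonnegative, and `X† X w = ‖X‖² w` turns the other into `‖X‖² w† S w`.
  obtain ⟨i, hi⟩ : ‖Xᴴ * X‖ ∈ Set.range hG.isHermitian.eigenvalues := by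
    rw [← hG.isHermitian.spectrum_real_eq_range_eigenvalues]
    open scoped MatrixOrder in
    exact CStarAlgebra.norm_mem_spectrum_of_nonneg (a := Xᴴ * X) hG.nonneg
  rw [l2_opNorm_conjTranspose_mul_self] at hi
  obtain ⟨w, hw1, hw⟩ : ∃ w : EuclideanSpace ℂ (Fin n), ‖w‖ = 1 ∧
      (Xᴴ * X) *ᵥ ofLp w = ((‖X‖ * ‖X‖ : ℝ) : ℂ) • ofLp w := by
    refine ⟨hG.isHermitian.eigenvectorBasis i, hG.isHermitian.eigenvectorBasis.orthonormal.1 i, ?_⟩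
    rw [hG.isHermitian.mulVec_eigenvectorBasis i, hi]
    rfl
  have key : (star (X *ᵥ ofLp w) ⬝ᵥ (A * X + X * S) *ᵥ ofLp w).re =
      (star (X *ᵥ ofLp w) ⬝ᵥ A *ᵥ (X *ᵥ ofLp w)).re +
        ‖X‖ * ‖X‖ * (star (ofLp w) ⬝ᵥ S *ᵥ ofLp w).re := by
    rw [add_mulVec, dotProduct_add, Complex.add_re, mulVec_mulVec]
    congr 1
    have h1 : star (X *ᵥ ofLp w) ⬝ᵥ (X * S) *ᵥ ofLp w =
        star ((Xᴴ * X) *ᵥ ofLp w) ⬝ᵥ S *ᵥ ofLp w := by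
      rw [← mulVec_mulVec, star_mulVec, star_mulVec, conjTranspose_mul, conjTranspose_conjTranspose,
        ← dotProduct_mulVec, ← dotProduct_mulVec, mulVec_mulVec, ← mulVec_mulVec, mulVec_mulVec]
    rw [h1, hw, star_smul, smul_dotProduct, smul_eq_mul]
    simp
  have hA0 : 0 ≤ (star (X *ᵥ ofLp w) ⬝ᵥ A *ᵥ (X *ᵥ ofLp w)).re :=
    (Complex.le_def.1 (hA.dotProduct_mulVec_nonneg (X *ᵥ ofLp w))).1
  have hS0 := hS (ofLp w)
  rw [show toLp 2 (ofLp w) = w from rfl, hw1] at hS0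
  have hXw : ‖toLp 2 (X *ᵥ ofLp w)‖ ≤ ‖X‖ := by
    simpa [hw1] using l2_opNorm_mulVec X w
  have hup := (le_abs_self _).trans
    (abs_re_star_dotProduct_mulVec_le (A * X + X * S) (X *ᵥ ofLp w) (ofLp w))
  rw [show toLp 2 (ofLp w) = w from rfl, hw1, mul_one, key] at hup
  have h2 : ‖A * X + X * S‖ * ‖toLp 2 (X *ᵥ ofLp w)‖ ≤ ‖A * X + X * S‖ * ‖X‖ := by gcongr
  have h3 : ‖X‖ * ‖X‖ * m ≤ ‖X‖ * ‖X‖ * (star (ofLp w) ⬝ᵥ S *ᵥ ofLp w).re := by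
    gcongr
    linarith
  refine le_of_mul_le_mul_right ?_ hXpos
  nlinarith

/-! ### Singular values and Weyl's inequality -/

theorem norm_toLp_mulVec_of_mem_unitaryGroup {U : Matrix (Fin n) (Fin n) ℂ}
    (hU : U ∈ unitaryGroup (Fin n) ℂ) (x : Fin n → ℂ) :
    ‖toLp 2 (U *ᵥ x)‖ = ‖toLp 2 x‖ := by
  rw [← sq_eq_sq₀ (norm_nonneg _) (norm_nonneg _), ← re_star_dotProduct_self,
    ← re_star_dotProduct_self, star_mulVec, ← dotProduct_mulVec, mulVec_mulVec]
  rw [← star_eq_conjTranspose, mem_unitaryGroup_iff'.1 hU, one_mulVec]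

theorem norm_toLp_diagonal_mulVec_sq (σ : Fin n → ℝ) (y : Fin n → ℂ) :
    ‖toLp 2 (diagonal (fun i => (σ i : ℂ)) *ᵥ y)‖ ^ 2 = ∑ i, σ i ^ 2 * ‖y i‖ ^ 2 := by
  rw [EuclideanSpace.norm_sq_eq]
  refine Finset.sum_congr rfl fun i _ => ?_
  rw [ofLp_toLp, mulVec_diagonal, norm_mul, Complex.norm_real, mul_pow, Real.norm_eq_abs, sq_abs]

theorem IsSVD.norm_mulVec_sq {A U V : Matrix (Fin n) (Fin n) ℂ} {σ : Fin n → ℝ}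
    (h : IsSVD A U V σ) (x : Fin n → ℂ) :
    ‖toLp 2 (A *ᵥ x)‖ ^ 2 = ∑ i, σ i ^ 2 * ‖(Vᴴ *ᵥ x) i‖ ^ 2 := by
  rw [h.eq, ← mulVec_mulVec, ← mulVec_mulVec,
    norm_toLp_mulVec_of_mem_unitaryGroup h.left_unitary, norm_toLp_diagonal_mulVec_sq]

theorem IsSVD.sum_norm_sq {A U V : Matrix (Fin n) (Fin n) ℂ} {σ : Fin n → ℝ}
    (h : IsSVD A U V σ) (x : Fin n → ℂ) :
    ∑ i, ‖(Vᴴ *ᵥ x) i‖ ^ 2 = ‖toLp 2 x‖ ^ 2 := by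
  rw [← norm_toLp_mulVec_of_mem_unitaryGroup (Unitary.star_mem h.right_unitary) x,
    EuclideanSpace.norm_sq_eq]
  rfl

/-- Weyl's inequality for singular values. -/
theorem IsSVD.le_add_norm_sub {A B U V U' V' : Matrix (Fin n) (Fin n) ℂ} {σ σ' : Fin n → ℝ}
    (hA : IsSVD A U V σ) (hB : IsSVD B U' V' σ') (i : Fin n) : σ i ≤ σ' i + ‖A - B‖ := by
  -- Dimension count: row `i` is zero, so the matrix is singular. A kernel vector has no `V'`
  -- components before `i` and no `V` components after `i`.
  obtain ⟨x, hx0, hx⟩ : ∃ x ≠ 0, (Matrix.of fun j k => if j < i then V'ᴴ j k else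
      if i < j then Vᴴ j k else 0 : Matrix (Fin n) (Fin n) ℂ) *ᵥ x = 0 :=
    exists_mulVec_eq_zero_iff.2 (det_eq_zero_of_row_eq_zero i fun j => by simp)
  have h1 (j : Fin n) (hj : j < i) : (V'ᴴ *ᵥ x) j = 0 := by
    simpa [mulVec, dotProduct, hj] using congrFun hx j
  have h2 (j : Fin n) (hj : i < j) : (Vᴴ *ᵥ x) j = 0 := by
    simpa [mulVec, dotProduct, hj, hj.not_gt] using congrFun hx j
  have hpos : 0 < ‖toLp 2 x‖ := norm_pos_iff.2 (by simpa using hx0)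
  have hlow : σ i * ‖toLp 2 x‖ ≤ ‖toLp 2 (A *ᵥ x)‖ := by
    rw [← sq_le_sq₀ (mul_nonneg (hA.nonneg i) hpos.le) (norm_nonneg _), mul_pow,
      hA.norm_mulVec_sq, ← hA.sum_norm_sq, Finset.mul_sum]
    refine Finset.sum_le_sum fun j _ => ?_
    rcases le_or_gt j i with hj | hj
    · have := hA.nonneg i
      have := hA.antitone hj
      gcongr
    · simp [h2 j hj]
  have hup : ‖toLp 2 (B *ᵥ x)‖ ≤ σ' i * ‖toLp 2 x‖ := by
    rw [← sq_le_sq₀ (norm_nonneg _) (mul_nonneg (hB.nonneg i) hpos.le), mul_pow,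
      hB.norm_mulVec_sq, ← hB.sum_norm_sq, Finset.mul_sum]
    refine Finset.sum_le_sum fun j _ => ?_
    rcases le_or_gt i j with hj | hj
    · have := hB.nonneg j
      have := hB.antitone hj
      gcongr
    · simp [h1 j hj]
  have hsub : ‖toLp 2 (A *ᵥ x)‖ ≤ ‖toLp 2 (B *ᵥ x)‖ + ‖A - B‖ * ‖toLp 2 x‖ := by
    have h3 := l2_opNorm_mulVec (A - B) (toLp 2 x)
    have h4 : toLp 2 (A *ᵥ x) = toLp 2 (B *ᵥ x) + toLp 2 ((A - B) *ᵥ x) := by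
      rw [← toLp_add, sub_mulVec, add_sub_cancel]
    rw [h4]
    exact (norm_add_le _ _).trans (by gcongr; exact h3)
  refine le_of_mul_le_mul_right ?_ hpos
  linarith

/-! ### Ordered eigenvalues and the low-rank approximation -/

theorem eig_succ {A : Matrix (Fin n) (Fin n) ℂ} (hA : A.IsHermitian) (i : Fin n) :
    eig hA (i + 1) = hA.eigenvalues₀ (finCongr (Fintype.card_fin n).symm i) := by
  rw [eig, dif_pos ⟨by omega, by simp⟩]
  rfl

theorem eig_nonneg {A : Matrix (Fin n) (Fin n) ℂ} (hA : A.PosSemidef) (j : ℕ) :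
    0 ≤ eig hA.isHermitian j := by
  unfold eig
  split_ifs with h
  · have := hA.eigenvalues_nonneg
      ((Fintype.equivOfCardEq (Fintype.card_fin _)) ⟨j - 1, by omega⟩)
    simpa [IsHermitian.eigenvalues] using this
  · exact le_rfl

theorem eig_antitone {A : Matrix (Fin n) (Fin n) ℂ} (hA : A.PosSemidef) {j k : ℕ} (hj : 1 ≤ j)
    (hjk : j ≤ k) : eig hA.isHermitian k ≤ eig hA.isHermitian j := by
  by_cases hk : k ≤ n
  · unfold eig
    rw [dif_pos ⟨by omega, by simpa⟩, dif_pos ⟨hj, by simp; omega⟩]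
    exact hA.isHermitian.eigenvalues₀_antitone (by simp; omega)
  · rw [show eig hA.isHermitian k = 0 by simp [eig, hk]]
    exact eig_nonneg hA j

/-- The spectral decomposition of a positive semidefinite matrix is a singular value
decomposition. -/
theorem exists_isSVD_eig {A : Matrix (Fin n) (Fin n) ℂ} (hA : A.PosSemidef) :
    ∃ W, IsSVD A W W fun i => eig hA.isHermitian (i + 1) := by
  -- `eigenvalues` is indexed through a chosen equivalence of index types; `e` undoes it, restoring
  -- the decreasing order.
  let e : Fin n ≃ Fin n :=
    (finCongr (Fintype.card_fin n).symm).trans (Fintype.equivOfCardEq (Fintype.card_fin _))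
  let E : Matrix (Fin n) (Fin n) ℂ := hA.isHermitian.eigenvectorUnitary
  have hE : E * Eᴴ = 1 := mem_unitaryGroup_iff.1 hA.isHermitian.eigenvectorUnitary.2
  have he (i : Fin n) : hA.isHermitian.eigenvalues (e i) = eig hA.isHermitian (i + 1) := by
    rw [eig_succ]
    simp [e, IsHermitian.eigenvalues]
  have hW : E.submatrix id e ∈ unitaryGroup (Fin n) ℂ := by
    rw [mem_unitaryGroup_iff, star_eq_conjTranspose, conjTranspose_submatrix,
      submatrix_mul_equiv, hE, submatrix_id_id]
  refine ⟨E.submatrix id e, hW, hW, fun i j hij => eig_antitone hA (by omega) ?_,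
    fun i => eig_nonneg hA _, ?_⟩
  · simpa using hij
  · have hd : diagonal (fun i : Fin n => ((eig hA.isHermitian (i + 1) : ℝ) : ℂ)) =
        (diagonal (RCLike.ofReal ∘ hA.isHermitian.eigenvalues)).submatrix e e := by
      rw [submatrix_diagonal_equiv]
      congr 1
      ext i
      simp [he]
    rw [hd, conjTranspose_submatrix, submatrix_mul_equiv, submatrix_mul_equiv, submatrix_id_id]
    conv_lhs => rw [hA.isHermitian.spectral_theorem]
    rfl

theorem lowRank_eq (U : Matrix (Fin n) (Fin n) ℂ) (σ : Fin n → ℝ) (r : ℕ) :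
    lowRank U σ r = U * diagonal (fun i => if i.val < r then (σ i : ℂ) else 0) * Uᴴ := by
  ext a b
  rw [lowRank, Finset.sum_filter, Matrix.sum_apply, mul_apply]
  refine Finset.sum_congr rfl fun i _ => ?_
  rw [mul_diagonal]
  split_ifs
  · simp [vecMulVec_apply, Matrix.col]
    ring
  · simp

theorem norm_diagonal_le {d : Fin n → ℂ} {b : ℝ} (hb : 0 ≤ b) (h : ∀ i, ‖d i‖ ≤ b) :
    ‖diagonal d‖ ≤ b := by
  rw [l2_opNorm_diagonal]
  exact (pi_norm_le_iff_of_nonneg hb).2 h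

/-- The Sylvester bound controls `X = (V - U) D`, and `Q⋆ - Q_r` splits into a term in `X`, the
singular values beyond `r`, and a term in `H`. Multiplying through by `λ_r` avoids division. -/
theorem norm_sub_lowRank_le {A H U V : Matrix (Fin n) (Fin n) ℂ} {σ : Fin n → ℝ} {r : ℕ}
    (hA : A.PosSemidef) (hr : 1 ≤ r) (hsvd : IsSVD (A + H) U V σ)
    (hH : 2 * ‖H‖ ≤ eig hA.isHermitian r) :
    eig hA.isHermitian r * ‖A - lowRank U σ r‖ ≤
      eig hA.isHermitian r * eig hA.isHermitian (r + 1) +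
        10 * (eig hA.isHermitian 1 * ‖H‖) := by
  have hr0 : 0 ≤ eig hA.isHermitian r := eig_nonneg hA r
  rcases hr0.eq_or_lt with hr0 | hr0
  · rw [← hr0]
    have := eig_nonneg hA 1
    simp only [zero_mul, zero_add]
    positivity
  have hrn : r ≤ n := by
    by_contra h
    simp [eig, h] at hr0
  obtain ⟨W, hW⟩ := exists_isSVD_eig hA
  have hup (i : Fin n) : σ i ≤ eig hA.isHermitian (i + 1) + ‖H‖ := by
    simpa using hsvd.le_add_norm_sub hW i
  have hlow (i : Fin n) : eig hA.isHermitian (i + 1) ≤ σ i + ‖H‖ := by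
    simpa [norm_sub_rev] using hW.le_add_norm_sub hsvd i
  let k : Fin n := ⟨r - 1, by omega⟩
  have hk : eig hA.isHermitian r ≤ 2 * σ k := by
    have := hlow k
    rw [show (k : ℕ) + 1 = r by simp [k]; omega] at this
    linarith
  let S : Matrix (Fin n) (Fin n) ℂ := diagonal fun i => (σ i : ℂ)
  let D : Matrix (Fin n) (Fin n) ℂ := diagonal fun i => if i.val < r then 1 else 0
  -- `T` agrees with `S` on the first `r` columns, the only ones `D` keeps, yet is at least `σ_r`
  -- everywhere, as the Sylvester bound requires.
  let T : Matrix (Fin n) (Fin n) ℂ := diagonal fun i => ((max (σ i) (σ k) : ℝ) : ℂ)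
  have hUU : U * Uᴴ = 1 := mem_unitaryGroup_iff.1 hsvd.left_unitary
  have hUU' : Uᴴ * U = 1 := mem_unitaryGroup_iff'.1 hsvd.left_unitary
  have hVV' : Vᴴ * V = 1 := mem_unitaryGroup_iff'.1 hsvd.right_unitary
  have hS : Sᴴ = S := by
    simp only [S, diagonal_conjTranspose]
    congr 1
    ext i
    simp
  have e1 : A * V = U * S - H * V := by
    have : (A + H) * V = U * S := by
      rw [hsvd.eq, Matrix.mul_assoc, hVV', Matrix.mul_one]
    rw [← this, Matrix.add_mul, add_sub_cancel_right]
  have e2 : A * U = V * S - Hᴴ * U := by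
    have h1 : (A + H)ᴴ * U = V * S := by
      rw [hsvd.eq, conjTranspose_mul, conjTranspose_mul, conjTranspose_conjTranspose,
        show (diagonal fun i => (σ i : ℂ))ᴴ = S from hS, Matrix.mul_assoc, Matrix.mul_assoc, hUU',
        Matrix.mul_one]
    rw [← h1, conjTranspose_add, hA.isHermitian.eq, Matrix.add_mul, add_sub_cancel_right]
  have hDS : S * D = D * S := by simp [S, D, diagonal_mul_diagonal, mul_comm]
  have hDT : D * T = D * S := by
    simp only [S, D, T, diagonal_mul_diagonal]
    congr 1
    ext i
    split_ifs with h
    · rw [max_eq_left (hsvd.antitone (by rw [Fin.le_def]; simp [k]; omega))]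
    · simp
  set X := (V - U) * D with hX
  have hsylv : A * X + X * T = (Hᴴ * U - H * V) * D := by
    rw [hX, Matrix.mul_assoc _ D, hDT, ← hDS, ← Matrix.mul_assoc, Matrix.mul_sub, e1, e2]
    noncomm_ring
  have hUn (Y : Matrix (Fin n) (Fin n) ℂ) : ‖Y * U‖ = ‖Y‖ :=
    CStarRing.norm_mul_mem_unitary Y hsvd.left_unitary
  have hVn (Y : Matrix (Fin n) (Fin n) ℂ) : ‖Y * V‖ = ‖Y‖ :=
    CStarRing.norm_mul_mem_unitary Y hsvd.right_unitary
  have hD1 : ‖D‖ ≤ 1 := norm_diagonal_le zero_le_one fun i => by split_ifs <;> simp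
  have hXn : σ k * ‖X‖ ≤ 2 * ‖H‖ := by
    have h1 : σ k * ‖X‖ ≤ ‖A * X + X * T‖ := by
      refine mul_norm_le_norm_mul_add_mul hA (fun w => ?_) X
      rw [EuclideanSpace.norm_sq_eq, Finset.mul_sum, dotProduct, Complex.re_sum]
      refine Finset.sum_le_sum fun i _ => ?_
      have : (star w i * (T *ᵥ w) i) = ((max (σ i) (σ k) * ‖w i‖ ^ 2 : ℝ) : ℂ) := by
        simp only [T, mulVec_diagonal, Pi.star_apply, RCLike.star_def]
        rw [mul_left_comm, Complex.conj_mul']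
        push_cast
        ring
      rw [this, Complex.ofReal_re]
      gcongr
      exact le_max_right _ _
    rw [hsylv] at h1
    refine h1.trans ((l2_opNorm_mul _ _).trans ?_)
    have h2 : ‖Hᴴ * U - H * V‖ ≤ 2 * ‖H‖ := by
      refine (norm_sub_le _ _).trans ?_
      rw [hUn, hVn, l2_opNorm_conjTranspose]
      linarith
    exact (mul_le_mul h2 hD1 (norm_nonneg _) (by positivity)).trans (by simp)
  have hS1 : ‖S‖ ≤ eig hA.isHermitian 1 + ‖H‖ := by
    refine norm_diagonal_le (add_nonneg (eig_nonneg hA 1) (norm_nonneg _)) fun i => ?_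
    rw [Complex.norm_real, Real.norm_of_nonneg (hsvd.nonneg i)]
    have := eig_antitone hA le_rfl (show 1 ≤ i.val + 1 by omega)
    linarith [hup i]
  have hS2 : ‖S * (1 - D)‖ ≤ eig hA.isHermitian (r + 1) + ‖H‖ := by
    have : S * (1 - D) = diagonal fun i => if i.val < r then 0 else (σ i : ℂ) := by
      rw [Matrix.mul_sub, Matrix.mul_one]
      simp only [S, D, diagonal_mul_diagonal, diagonal_sub]
      congr 1
      ext i
      split_ifs <;> simp
    rw [this]
    refine norm_diagonal_le (add_nonneg (eig_nonneg hA _) (norm_nonneg _)) fun i => ?_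
    split_ifs with h
    · simpa using (add_nonneg (eig_nonneg hA (r + 1)) (norm_nonneg H))
    · rw [Complex.norm_real, Real.norm_of_nonneg (hsvd.nonneg i)]
      have := eig_antitone hA (show 1 ≤ r + 1 by omega) (show r + 1 ≤ i.val + 1 by omega)
      linarith [hup i]
  have hdec : A - lowRank U σ r = (X * S + V * (S * (1 - D)) - Hᴴ * U) * Uᴴ := by
    have h1 : lowRank U σ r = U * (D * S) * Uᴴ := by
      rw [lowRank_eq]
      simp only [S, D, diagonal_mul_diagonal]
      congr 3
      ext i
      split_ifs <;> simp
    have h2 : A = (V * S - Hᴴ * U) * Uᴴ := by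
      rw [← e2, Matrix.mul_assoc, hUU, Matrix.mul_one]
    conv_lhs => rw [h1, h2]
    rw [← Matrix.sub_mul, hX, Matrix.mul_assoc _ D S, Matrix.mul_sub S, hDS]
    noncomm_ring
  have hnorm : ‖A - lowRank U σ r‖ ≤
      ‖X‖ * (eig hA.isHermitian 1 + ‖H‖) + (eig hA.isHermitian (r + 1) + ‖H‖) + ‖H‖ := by
    rw [hdec]
    rw [CStarRing.norm_mul_mem_unitary (U := Uᴴ) _ (Unitary.star_mem hsvd.left_unitary)]
    refine (norm_sub_le _ _).trans (add_le_add ((norm_add_le _ _).trans (add_le_add ?_ ?_)) ?_)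
    · exact (l2_opNorm_mul _ _).trans (by gcongr)
    · rw [CStarRing.norm_mem_unitary_mul _ hsvd.right_unitary]
      exact hS2
    · rw [hUn, l2_opNorm_conjTranspose]
  have h1r := eig_antitone hA le_rfl hr
  have hh := norm_nonneg H
  -- From `σ_r ‖X‖ ≤ 2‖H‖` and `λ_r ≤ 2 σ_r`.
  have hXr : eig hA.isHermitian r * ‖X‖ ≤ 4 * ‖H‖ := by
    nlinarith [norm_nonneg X]
  have h5 : eig hA.isHermitian r * ‖X‖ * (eig hA.isHermitian 1 + ‖H‖) ≤
      4 * ‖H‖ * (eig hA.isHermitian 1 + ‖H‖) := by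
    gcongr
    linarith
  have h6 := mul_le_mul_of_nonneg_left hnorm hr0.le
  have h7 : eig hA.isHermitian r * ‖H‖ ≤ eig hA.isHermitian 1 * ‖H‖ := by gcongr
  nlinarith

/-! ### Stability of the optimal value -/

theorem norm_sq_of_mem_feasible {K : ℕ} {z : Fin n → ℂ} (hz : z ∈ feasible K n) :
    ‖toLp 2 z‖ ^ 2 = n := by
  rw [EuclideanSpace.norm_sq_eq]
  have h (i : Fin n) : ‖z i‖ = 1 := by
    obtain ⟨k, -, hk⟩ := hz i
    rw [hk, show (2 * k * Real.pi * Complex.I / K : ℂ) =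
      ((2 * k * Real.pi / K : ℝ) : ℂ) * Complex.I by push_cast; ring]
    exact Complex.norm_exp_ofReal_mul_I _
  simp [h]

theorem abs_quadForm_sub_le {K : ℕ} (A B : Matrix (Fin n) (Fin n) ℂ) {z : Fin n → ℂ}
    (hz : z ∈ feasible K n) : |quadForm A z - quadForm B z| ≤ n * ‖A - B‖ := by
  have h := abs_re_star_dotProduct_mulVec_le (A - B) z z
  rw [sub_mulVec, dotProduct_sub, Complex.sub_re, mul_assoc, ← sq, norm_sq_of_mem_feasible hz,
    mul_comm] at h
  exact h

/-- Pass from `A` to `B` at an optimum `w` of `A`, use that `z` is optimal for `B`, and return to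
`A` at `z`; each passage costs `n‖A - B‖`. -/
theorem abs_opt_sub_quadForm_le {K : ℕ} (hK : 0 < K) (A B : Matrix (Fin n) (Fin n) ℂ)
    {z : Fin n → ℂ} (hz : IsMaximizer K B z) :
    |opt K A - quadForm A z| ≤ 2 * (n * ‖A - B‖) := by
  obtain ⟨⟨w, hw, hwo⟩, hmax⟩ := isGreatest_opt hK A
  rw [abs_of_nonneg (sub_nonneg.2 (hmax ⟨z, hz.1, rfl⟩)), ← hwo]
  have h1 := (abs_le.1 (abs_quadForm_sub_le A B hw)).2
  have h2 := (abs_le.1 (abs_quadForm_sub_le A B hz.1)).1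
  have h3 := hz.2 w hw
  linarith

theorem eigengap_le_eig {A : Matrix (Fin n) (Fin n) ℂ} (hA : A.IsHermitian) (r : ℕ) :
    eigengap hA r ≤ eig hA r :=
  Finset.min'_le _ _ (Finset.mem_insert_self _ _)

end Deterministic

/-! ### Nets and the operator norm of a Gaussian matrix -/

section Probabilistic

open scoped Matrix.Norms.L2Operator
open WithLp Matrix

theorem packingNumber_one_closedBall_two_le (E : Type*) [NormedAddCommGroup E] [NormedSpace ℝ E]
    [FiniteDimensional ℝ E] :
    Metric.packingNumber 1 (Metric.closedBall (0 : E) 2) ≤ (5 ^ Module.finrank ℝ E : ℕ) := by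
  refine iSup_le fun C => iSup_le fun hC => iSup_le fun hsep => ?_
  by_contra! hlt
  -- `C` may be infinite a priori, so the volume bound is applied to a subset of exactly `5 ^ d + 1`
  -- points.
  obtain ⟨t, htC, ht⟩ := Set.exists_subset_encard_eq (Order.add_one_le_of_lt hlt)
  have hfin : t.Finite := Set.finite_of_encard_eq_coe
    (k := 5 ^ Module.finrank ℝ E + 1) (by rw [ht]; rfl)
  have hcard := Besicovitch.card_le_of_separated hfin.toFinset
    (fun c hc => by simpa using hC (htC (hfin.mem_toFinset.1 hc)))
    (fun c hc d hd hcd => by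
      have := hsep (htC (hfin.mem_toFinset.1 hc)) (htC (hfin.mem_toFinset.1 hd)) hcd
      beta_reduce at this
      rw [edist_dist, ENNReal.coe_one, ← ENNReal.ofReal_one,
        ENNReal.ofReal_lt_ofReal_iff_of_nonneg zero_le_one, dist_eq_norm] at this
      exact this.le)
  rw [hfin.encard_eq_coe_toFinset_card] at ht
  have : hfin.toFinset.card = 5 ^ Module.finrank ℝ E + 1 := by exact_mod_cast ht
  omega

/-- The unit ball of a real normed space of dimension `d` has a `1/2`-net of at most `5 ^ d`
points. -/
theorem exists_half_net (E : Type*) [NormedAddCommGroup E] [NormedSpace ℝ E]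
    [FiniteDimensional ℝ E] :
    ∃ N : Finset E, N.card ≤ 5 ^ Module.finrank ℝ E ∧ (∀ x ∈ N, ‖x‖ ≤ 1) ∧
      ∀ y : E, ‖y‖ ≤ 1 → ∃ x ∈ N, ‖y - x‖ ≤ 1 / 2 := by
  classical
  have hP := packingNumber_one_closedBall_two_le E
  have hne : Metric.packingNumber 1 (Metric.closedBall (0 : E) 2) ≠ ⊤ :=
    (hP.trans_lt (ENat.natCast_lt_top _)).ne
  set C := Metric.maximalSeparatedSet 1 (Metric.closedBall (0 : E) 2)
  have hcard : C.encard ≤ (5 ^ Module.finrank ℝ E : ℕ) :=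
    (Metric.encard_maximalSeparatedSet hne).trans_le hP
  have hfin : C.Finite := Set.finite_of_encard_le_coe hcard
  -- A maximal 1-separated subset of the ball of radius 2 is a 1-net of it; halving gives the
  -- required net.
  refine ⟨hfin.toFinset.image fun x => (2⁻¹ : ℝ) • x, ?_, ?_, ?_⟩
  · refine Finset.card_image_le.trans ?_
    rw [hfin.encard_eq_coe_toFinset_card] at hcard
    exact_mod_cast hcard
  · intro x hx
    obtain ⟨c, hc, rfl⟩ := Finset.mem_image.1 hx
    have := Metric.maximalSeparatedSet_subset (hfin.mem_toFinset.1 hc)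
    rw [mem_closedBall_zero_iff] at this
    rw [norm_smul]
    norm_num
    linarith
  · intro y hy
    obtain ⟨c, hc, hyc⟩ := Metric.isCover_maximalSeparatedSet hne
      (show (2 : ℝ) • y ∈ Metric.closedBall (0 : E) 2 by
        rw [mem_closedBall_zero_iff, norm_smul]; norm_num; linarith)
    refine ⟨_, Finset.mem_image_of_mem _ (hfin.mem_toFinset.2 hc), ?_⟩
    have h1 : ‖(2 : ℝ) • y - c‖ ≤ 1 := by
      have : edist ((2 : ℝ) • y) c ≤ 1 := hyc
      rw [edist_dist, ← ENNReal.ofReal_one, ENNReal.ofReal_le_ofReal_iff zero_le_one,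
        dist_eq_norm] at this
      exact this
    have h2 : y - (2⁻¹ : ℝ) • c = (2⁻¹ : ℝ) • ((2 : ℝ) • y - c) := by
      rw [smul_sub, smul_smul]
      norm_num
    rw [h2, norm_smul]
    norm_num
    linarith

variable {n : ℕ}

/-- Discretising the right vector loses a factor 2, since the error `‖A‖ / 2` is absorbed on the
left; discretising the left vector loses another. -/
theorem exists_mem_net_norm_le {N : Finset (EuclideanSpace ℂ (Fin n))}
    (hN : ∀ y, ‖y‖ ≤ 1 → ∃ x ∈ N, ‖y - x‖ ≤ 1 / 2) (A : Matrix (Fin n) (Fin n) ℂ) :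
    ∃ x ∈ N, ∃ y ∈ N, ‖A‖ ≤ 4 * (star (ofLp x) ⬝ᵥ A *ᵥ ofLp y).re := by
  obtain ⟨y, hy, hyA⟩ : ∃ y ∈ N, ‖A‖ ≤ 2 * ‖toLp 2 (A *ᵥ ofLp y)‖ := by
    obtain ⟨x₀, hx₀, -⟩ := hN 0 (by simp)
    obtain ⟨y, hy, hmax⟩ := N.exists_max_image (fun y => ‖toLp 2 (A *ᵥ ofLp y)‖) ⟨x₀, hx₀⟩
    refine ⟨y, hy, ?_⟩
    suffices ‖A‖ ≤ ‖toLp 2 (A *ᵥ ofLp y)‖ + ‖A‖ * (1 / 2) by linarith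
    rw [cstar_norm_def]
    refine ContinuousLinearMap.opNorm_le_of_unit_norm (𝕜 := ℂ) (by positivity) fun w hw => ?_
    obtain ⟨u, hu, hwu⟩ := hN w hw.le
    have h1 : toEuclideanCLM (n := Fin n) (𝕜 := ℂ) A w =
        toLp 2 (A *ᵥ ofLp u) + toEuclideanCLM (n := Fin n) (𝕜 := ℂ) A (w - u) := by
      rw [map_sub, show toLp 2 (A *ᵥ ofLp u) = toEuclideanCLM (n := Fin n) (𝕜 := ℂ) A u from rfl]
      abel
    rw [h1]
    refine (norm_add_le _ _).trans (add_le_add (hmax u hu) ?_)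
    exact (ContinuousLinearMap.le_opNorm _ _).trans (by gcongr)
  obtain ⟨x, hx, hxA⟩ : ∃ x ∈ N, ‖toLp 2 (A *ᵥ ofLp y)‖ ≤
      2 * (star (ofLp x) ⬝ᵥ A *ᵥ ofLp y).re := by
    set v := toLp 2 (A *ᵥ ofLp y) with hv
    have hre (x : EuclideanSpace ℂ (Fin n)) :
        star (ofLp x) ⬝ᵥ A *ᵥ ofLp y = inner ℂ x v := by
      rw [EuclideanSpace.inner_eq_star_dotProduct, dotProduct_comm]
    obtain ⟨x, hx, hxu⟩ := hN (((‖v‖⁻¹ : ℝ) : ℂ) • v) (by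
      rw [norm_smul, Complex.norm_real, norm_inv, norm_norm]
      exact inv_mul_le_one)
    refine ⟨x, hx, ?_⟩
    rw [hre]
    have h1 : (inner ℂ (((‖v‖⁻¹ : ℝ) : ℂ) • v) v).re = ‖v‖ := by
      rw [inner_smul_left, inner_self_eq_norm_sq_to_K, Complex.conj_ofReal]
      rcases eq_or_ne ‖v‖ 0 with h | h
      · simp [h]
      · rw [show ((‖v‖⁻¹ : ℝ) : ℂ) * (RCLike.ofReal ‖v‖) ^ 2 = ((‖v‖⁻¹ * ‖v‖ ^ 2 : ℝ) : ℂ) by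
          push_cast; rfl, Complex.ofReal_re]
        field_simp
    have h2 : (inner ℂ (((‖v‖⁻¹ : ℝ) : ℂ) • v - x) v).re ≤ 1 / 2 * ‖v‖ :=
      (Complex.re_le_norm _).trans ((norm_inner_le_norm _ _).trans (by gcongr))
    rw [inner_sub_left, Complex.sub_re, h1] at h2
    linarith
  exact ⟨x, hx, y, hy, by linarith⟩

/-! ### Sub-Gaussian tails -/

theorem hasSubgaussianMGF_const_mul_gaussianReal (a : ℝ) (v : ℝ≥0) :
    HasSubgaussianMGF (fun x => a * x) (‖a‖₊ ^ 2 * v) (gaussianReal 0 v) := by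
  have h : HasSubgaussianMGF id v (gaussianReal 0 v) :=
    ⟨fun t => integrable_exp_mul_gaussianReal t, fun t => by rw [mgf_id_gaussianReal]; simp⟩
  have ha := h.const_mul a
  simp only [id] at ha
  convert ha using 1
  refine NNReal.eq ?_
  change ‖a‖ ^ 2 * (v : ℝ) = a ^ 2 * v
  rw [Real.norm_eq_abs, sq_abs]

theorem hasSubgaussianMGF_re_mul_complexGaussian (c : ℂ) (v : ℝ≥0) :
    HasSubgaussianMGF (fun z : ℂ => (c * z).re) (‖c‖₊ ^ 2 * (v / 2)) (complexGaussian v) := by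
  have hmeas : Measurable (fun p : ℝ × ℝ => (⟨p.1, p.2⟩ : ℂ)) :=
    Complex.measurableEquivRealProd.symm.measurable
  have h1 : HasSubgaussianMGF (fun p : ℝ × ℝ => c.re * p.1 + -c.im * p.2)
      (‖c.re‖₊ ^ 2 * (v / 2) + ‖-c.im‖₊ ^ 2 * (v / 2))
      ((gaussianReal 0 (v / 2)).prod (gaussianReal 0 (v / 2))) := by
    refine HasSubgaussianMGF.add_of_indepFun
      (HasSubgaussianMGF.of_map (Y := Prod.fst) measurable_fst.aemeasurable ?_)
      (HasSubgaussianMGF.of_map (Y := Prod.snd) measurable_snd.aemeasurable ?_)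
      (indepFun_prod (by fun_prop) (by fun_prop))
    · rw [← Measure.fst, Measure.fst_prod]
      exact hasSubgaussianMGF_const_mul_gaussianReal c.re (v / 2)
    · rw [← Measure.snd, Measure.snd_prod]
      exact hasSubgaussianMGF_const_mul_gaussianReal (-c.im) (v / 2)
  have hc : ‖c‖₊ ^ 2 * (v / 2) = ‖c.re‖₊ ^ 2 * (v / 2) + ‖-c.im‖₊ ^ 2 * (v / 2) := by
    rw [← add_mul]
    congr 1
    ext
    rw [NNReal.coe_pow, coe_nnnorm, Complex.sq_norm, Complex.normSq_apply]
    simp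
    ring
  rw [complexGaussian, hc]
  constructor
  · intro t
    rw [integrable_map_measure (by fun_prop) hmeas.aemeasurable]
    convert h1.integrable_exp_mul t using 1
    ext p
    simp [Complex.mul_re, sub_eq_add_neg]
  · intro t
    rw [mgf, integral_map hmeas.aemeasurable (by fun_prop)]
    convert h1.mgf_le t using 1
    simp [mgf, Complex.mul_re, sub_eq_add_neg]

/-- The form is a sum of independent terms `Re (conj x_i * y_k * H_ik)`, whose variance proxies add
up, and `∑ |x_i|² |y_k|² = ‖x‖² ‖y‖²`. -/
theorem hasSubgaussianMGF_re_star_dotProduct_mulVec {Ω : Type*} [MeasurableSpace Ω] {μ : Measure Ω}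
    {H : Ω → Matrix (Fin n) (Fin n) ℂ} {v : ℝ≥0}
    (hH : ∀ i k, HasLaw (fun ω => H ω i k) (complexGaussian v) μ)
    (hindep : iIndepFun (fun (p : Fin n × Fin n) ω => H ω p.1 p.2) μ) (x y : Fin n → ℂ) :
    HasSubgaussianMGF (fun ω => (star x ⬝ᵥ H ω *ᵥ y).re)
      (‖toLp 2 x‖₊ ^ 2 * ‖toLp 2 y‖₊ ^ 2 * (v / 2)) μ := by
  have hsum := HasSubgaussianMGF.sum_of_iIndepFun (s := Finset.univ)
    (c := fun p : Fin n × Fin n => ‖star (x p.1) * y p.2‖₊ ^ 2 * (v / 2))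
    (hindep.comp (fun p z => ((star (x p.1) * y p.2) * z).re) fun p => by fun_prop)
    fun p _ => HasSubgaussianMGF.of_map (hH p.1 p.2).aemeasurable (by
      rw [(hH p.1 p.2).map_eq]
      exact hasSubgaussianMGF_re_mul_complexGaussian _ v)
  convert hsum using 1
  · ext ω
    rw [Fintype.sum_prod_type, dotProduct, Complex.re_sum]
    refine Finset.sum_congr rfl fun i _ => ?_
    rw [mulVec, dotProduct, Finset.mul_sum, Complex.re_sum]
    refine Finset.sum_congr rfl fun k _ => ?_
    simp only [Function.comp_apply, Pi.star_apply]
    congr 1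
    ring
  · rw [← Finset.sum_mul, Fintype.sum_prod_type, EuclideanSpace.nnnorm_eq, EuclideanSpace.nnnorm_eq,
      NNReal.sq_sqrt, NNReal.sq_sqrt, Finset.sum_mul_sum]
    simp [mul_pow]

/-- The operator norm of a complex Gaussian matrix is of order `√n` with exponentially high
probability. -/
theorem measureReal_norm_gt_le {Ω : Type*} [MeasurableSpace Ω] {μ : Measure Ω}
    [IsProbabilityMeasure μ] {H : Ω → Matrix (Fin n) (Fin n) ℂ} {α : ℝ} (hα : 0 ≤ α)
    (hH : ∀ i k, HasLaw (fun ω => H ω i k) (complexGaussian (α ^ 2).toNNReal) μ)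
    (hindep : iIndepFun (fun (p : Fin n × Fin n) ω => H ω p.1 p.2) μ) :
    μ.real {ω | 12 * α * √n < ‖H ω‖} ≤ Real.exp (-n) := by
  obtain ⟨N, hcard, hN1, hN⟩ := exists_half_net (EuclideanSpace ℂ (Fin n))
  have hsub (x y : EuclideanSpace ℂ (Fin n)) :=
    hasSubgaussianMGF_re_star_dotProduct_mulVec hH hindep (ofLp x) (ofLp y)
  -- The net loses a factor 4, so level `12 α √n` becomes `3 α √n`. The proxy is at most `α² / 2`,
  -- giving tails `exp (-9n)`, which beat the at most `exp (8n)` pairs.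
  have hincl : {ω | 12 * α * √n < ‖H ω‖} ⊆ ⋃ p ∈ N ×ˢ N,
      {ω | 3 * α * √n < (star (ofLp p.1) ⬝ᵥ H ω *ᵥ ofLp p.2).re} := by
    intro ω hω
    obtain ⟨x, hx, y, hy, h⟩ := exists_mem_net_norm_le hN (H ω)
    rw [Set.mem_ofPred_eq] at hω
    simp only [Set.mem_iUnion]
    exact ⟨(x, y), Finset.mem_product.2 ⟨hx, hy⟩, show 3 * α * √n < _ by linarith⟩
  have hbound (p : EuclideanSpace ℂ (Fin n) × EuclideanSpace ℂ (Fin n)) (hp : p ∈ N ×ˢ N) :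
      μ.real {ω | 3 * α * √n < (star (ofLp p.1) ⬝ᵥ H ω *ᵥ ofLp p.2).re} ≤
        Real.exp (-(9 * n)) := by
    rw [Finset.mem_product] at hp
    have hs := hsub p.1 p.2
    set c : ℝ≥0 := ‖toLp 2 (ofLp p.1)‖₊ ^ 2 * ‖toLp 2 (ofLp p.2)‖₊ ^ 2 * ((α ^ 2).toNNReal / 2)
      with hc
    have hcle : 2 * (c : ℝ) ≤ α ^ 2 := by
      have h1 : (c : ℝ) = ‖p.1‖ ^ 2 * ‖p.2‖ ^ 2 * (α ^ 2 / 2) := by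
        simp [hc, sq_nonneg]
      have h2 : ‖p.1‖ ^ 2 * ‖p.2‖ ^ 2 ≤ 1 :=
        mul_le_one₀ (pow_le_one₀ (norm_nonneg _) (hN1 _ hp.1)) (by positivity)
          (pow_le_one₀ (norm_nonneg _) (hN1 _ hp.2))
      rw [h1]
      nlinarith [sq_nonneg α]
    -- The Chernoff exponent divides by `2c`; when `c = 0` the form vanishes almost surely.
    rcases eq_or_ne c 0 with hc0 | hc0
    · rw [hc0] at hs
      have h0 : μ {ω | 3 * α * √n < (star (ofLp p.1) ⬝ᵥ H ω *ᵥ ofLp p.2).re} = 0 := by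
        refine measure_mono_null (fun ω hω => ?_) (ae_iff.1 hs.ae_eq_zero_of_hasSubgaussianMGF_zero)
        have : 0 ≤ 3 * α * √n := by positivity
        exact (this.trans_lt hω).ne'
      rw [measureReal_def, h0]
      simpa using (Real.exp_pos _).le
    · have hcpos : (0 : ℝ) < c := NNReal.coe_pos.2 (pos_iff_ne_zero.2 hc0)
      have hmono : {ω | 3 * α * √n < (star (ofLp p.1) ⬝ᵥ H ω *ᵥ ofLp p.2).re} ⊆
          {ω | 3 * α * √n ≤ (star (ofLp p.1) ⬝ᵥ H ω *ᵥ ofLp p.2).re} :=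
        Set.ofPred_subset_ofPred.2 fun _ => le_of_lt
      refine (measureReal_mono hmono).trans
        ((hs.measure_ge_le (ε := 3 * α * √n) (by positivity)).trans ?_)
      rw [Real.exp_le_exp, neg_div, neg_le_neg_iff, le_div_iff₀ (by positivity), mul_pow, mul_pow,
        Real.sq_sqrt (by positivity)]
      have : (0 : ℝ) ≤ 9 * n := by positivity
      nlinarith
  have hcardN : (N.card : ℝ) ≤ Real.exp (4 * n) := by
    have h1 : Module.finrank ℝ (EuclideanSpace ℂ (Fin n)) = 2 * n := by
      rw [← Module.finrank_mul_finrank ℝ ℂ]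
      simp
    rw [h1] at hcard
    have h2 : (5 : ℝ) ≤ Real.exp 2 := by
      have := Real.add_one_le_exp (1 : ℝ)
      have h3 := Real.exp_one_gt_d9
      rw [show (2 : ℝ) = 1 + 1 by norm_num, Real.exp_add]
      nlinarith
    calc (N.card : ℝ) ≤ 5 ^ (2 * n) := by exact_mod_cast hcard
      _ ≤ Real.exp 2 ^ (2 * n) := by gcongr
      _ = Real.exp (4 * n) := by
        rw [← Real.exp_nat_mul]
        push_cast
        ring_nf
  calc μ.real {ω | 12 * α * √n < ‖H ω‖}
      ≤ μ.real (⋃ p ∈ N ×ˢ N, {ω | 3 * α * √n < (star (ofLp p.1) ⬝ᵥ H ω *ᵥ ofLp p.2).re}) :=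
        measureReal_mono hincl (measure_ne_top _ _)
    _ ≤ ∑ p ∈ N ×ˢ N, μ.real {ω | 3 * α * √n < (star (ofLp p.1) ⬝ᵥ H ω *ᵥ ofLp p.2).re} :=
        measureReal_biUnion_finset_le _ _
    _ ≤ ∑ p ∈ N ×ˢ N, Real.exp (-(9 * n)) := Finset.sum_le_sum hbound
    _ = N.card * N.card * Real.exp (-(9 * n)) := by
        rw [Finset.sum_const, Finset.card_product, nsmul_eq_mul]
        push_cast
        rfl
    _ ≤ Real.exp (4 * n) * Real.exp (4 * n) * Real.exp (-(9 * n)) := by gcongr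
    _ = Real.exp (-n) := by
        rw [← Real.exp_add, ← Real.exp_add]
        ring_nf

/-! ### Combining both halves -/

theorem exists_measurableSet_abs_opt_sub_quadForm_le {K r : ℕ} (hK : 0 < K) (hr : 1 ≤ r)
    {Qs : Matrix (Fin n) (Fin n) ℂ} (hQs : Qs.PosSemidef) (hgap : 0 < eigengap hQs.isHermitian r)
    {α : ℝ} (hα : 0 ≤ α) (hαc : α ≤ 1 / 24 * eigengap hQs.isHermitian r / √n)
    {Ω : Type*} [MeasurableSpace Ω] {μ : Measure Ω} [IsProbabilityMeasure μ]
    {H : Ω → Matrix (Fin n) (Fin n) ℂ}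
    (hH : ∀ i k, HasLaw (fun ω => H ω i k) (complexGaussian (α ^ 2).toNNReal) μ)
    (hindep : iIndepFun (fun (p : Fin n × Fin n) ω => H ω p.1 p.2) μ) :
    ∃ E : Set Ω, MeasurableSet E ∧ 1 - Real.exp (-n) ≤ μ.real E ∧
      ∀ ω ∈ E, ∀ (U V : Matrix (Fin n) (Fin n) ℂ) (σ : Fin n → ℝ) (zr : Fin n → ℂ),
        IsSVD (Qs + H ω) U V σ → IsMaximizer K (lowRank U σ r) zr →
        |opt K Qs - quadForm Qs zr| ≤
          240 * (n * eig hQs.isHermitian (r + 1) +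
            (n : ℝ) ^ (3 / 2 : ℝ) * eig hQs.isHermitian 1 * α / eigengap hQs.isHermitian r) := by
  -- The entries of `H` are only a.e. measurable, so the bad event is replaced by a measurable hull
  -- of equal measure.
  refine ⟨(toMeasurable μ {ω | 12 * α * √n < ‖H ω‖})ᶜ, (measurableSet_toMeasurable _ _).compl,
    ?_, ?_⟩
  · rw [measureReal_compl (measurableSet_toMeasurable _ _), probReal_univ, measureReal_def,
      measure_toMeasurable, ← measureReal_def]
    linarith [measureReal_norm_gt_le hα hH hindep]
  intro ω hω U V σ zr hsvd hmax
  have hHω : ‖H ω‖ ≤ 12 * α * √n :=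
    not_lt.1 fun h => hω (subset_toMeasurable μ {ω | 12 * α * √n < ‖H ω‖} h)
  have hgr := eigengap_le_eig hQs.isHermitian r
  set δ := eigengap hQs.isHermitian r
  set l := eig hQs.isHermitian r
  have hn : 0 < n := by
    rcases Nat.eq_zero_or_pos n with rfl | hn
    · have : l = 0 := dif_neg (by simp; omega)
      linarith
    · exact hn
  have hsn : 0 < √(n : ℝ) := Real.sqrt_pos.2 (by exact_mod_cast hn)
  rw [le_div_iff₀ hsn] at hαc
  -- The constant `1 / 24` gives `2‖H‖ ≤ 24 α √n ≤ δ ≤ λ_r`.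
  have hdet := norm_sub_lowRank_le hQs hr hsvd (by change _ ≤ l; linarith)
  change l * _ ≤ l * _ + _ at hdet
  have hopt := abs_opt_sub_quadForm_le hK Qs _ hmax
  set lr := eig hQs.isHermitian (r + 1)
  have hl1 : 0 ≤ eig hQs.isHermitian 1 := eig_nonneg hQs 1
  set l1 := eig hQs.isHermitian 1
  have hlr : 0 ≤ lr := eig_nonneg hQs (r + 1)
  have hlpos : 0 < l := hgap.trans_le hgr
  -- Here `120 = 10 * 12`, from the perturbation bound and the norm bound; the final 240 includes
  -- the factor 2 from optimisation.
  have hnorm : ‖Qs - lowRank U σ r‖ ≤ lr + 120 * (l1 * α * √n / δ) := by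
    have h1 : ‖Qs - lowRank U σ r‖ ≤ lr + 120 * (l1 * α * √n / l) := by
      refine le_of_mul_le_mul_left (hdet.trans ?_) hlpos
      have h2 : l1 * ‖H ω‖ ≤ l1 * (12 * α * √n) := by gcongr
      have h3 : l * (lr + 120 * (l1 * α * √n / l)) = l * lr + 120 * (l1 * α * √n) := by
        field_simp
      linarith
    refine h1.trans ?_
    gcongr
  have hpow : (n : ℝ) ^ (3 / 2 : ℝ) = n * √n := by
    rw [Real.sqrt_eq_rpow, show (3 / 2 : ℝ) = 1 + 1 / 2 by norm_num,
      Real.rpow_add (by exact_mod_cast hn), Real.rpow_one]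
  refine hopt.trans ?_
  rw [hpow]
  calc 2 * (n * ‖Qs - lowRank U σ r‖)
      ≤ 2 * (n * (lr + 120 * (l1 * α * √n / δ))) := by gcongr
    _ = 2 * (n * lr) + 240 * (n * √n * l1 * α / δ) := by ring
    _ ≤ 240 * (n * lr + n * √n * l1 * α / δ) := by
      have : 0 ≤ n * lr := by positivity
      linarith

end Probabilistic

end LowRankQuad

theorem mainTheorem7 :
    ∃ c > (0 : ℝ), ∃ C > (0 : ℝ), ∃ c' > (0 : ℝ), ∃ M > (0 : ℝ),
      ∀ (n K r : ℕ) (_ : 2 ≤ K) (_ : 1 ≤ r)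
        (Qs : Matrix (Fin n) (Fin n) ℂ) (hQs : Qs.PosSemidef)
        (_ : 0 < LowRankQuad.eigengap hQs.isHermitian r)
        (α : ℝ) (_ : 0 ≤ α)
        (_ : α ≤ c * LowRankQuad.eigengap hQs.isHermitian r / √n)
        (Ω : Type*) [MeasurableSpace Ω] (μ : Measure Ω) [IsProbabilityMeasure μ]
        (H : Ω → Matrix (Fin n) (Fin n) ℂ)
        (_ : ∀ i k, HasLaw (fun ω => H ω i k) (LowRankQuad.complexGaussian (α ^ 2).toNNReal) μ)
        (_ : iIndepFun (fun (p : Fin n × Fin n) ω => H ω p.1 p.2) μ),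
        ∃ E : Set Ω, MeasurableSet E ∧ 1 - C * Real.exp (-(c' * n)) ≤ μ.real E ∧
          ∀ ω ∈ E, ∀ (U V : Matrix (Fin n) (Fin n) ℂ) (σ : Fin n → ℝ) (zr : Fin n → ℂ),
            LowRankQuad.IsSVD (Qs + H ω) U V σ →
            LowRankQuad.IsMaximizer K (LowRankQuad.lowRank U σ r) zr →
            |LowRankQuad.opt K Qs - LowRankQuad.quadForm Qs zr| ≤
              M * (n * LowRankQuad.eig hQs.isHermitian (r + 1) +
                (n : ℝ) ^ (3 / 2 : ℝ) * LowRankQuad.eig hQs.isHermitian 1 * α /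
                  LowRankQuad.eigengap hQs.isHermitian r) := by
  refine ⟨1 / 24, by norm_num, 1, one_pos, 1, one_pos, 240, by norm_num, ?_⟩
  intro n K r hK hr Qs hQs hgap α hα hαc Ω _ μ _ H hH hindep
  rw [one_mul, one_mul]
  exact LowRankQuad.exists_measurableSet_abs_opt_sub_quadForm_le (by omega) hr hQs hgap hα hαc hH
    hindep
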